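/- Let $\zeta(s,a)$ denote the Hurwitz zeta function with complex parameter $a$, $\operatorname{Re} a>0$: the analytic continuation in $s$ to $\mathbb{C}\setminus\{1\}$ of $\sum_{n\ge 0}(n+a)^{-s}$ (principal powers, $\operatorname{Re} s>1$). Let $\psi=\Gamma'/\Gamma$ be the digamma function, $\gamma$ Euler's constant, and for $n=0,1,2,\dots$ put $$g(n,a)=\zeta'(-n,a)+\psi(n+1)\,\zeta(-n,a),$$ where the prime denotes differentiation with respect to the first variable. Then for every integer $p\ge 1$ and all complex $a,t$ with $\operatorname{Re} a>0$ and $|t|<\operatorname{Re} a$, the series $$T(t,a,p)=\sum_{n=1}^{\infty}\frac{\zeta(n+1,a)}{(n+1)(n+2)\cdots(n+p)}\,t^{n+p}$$ converges (absolutely) and $$T(t,a,p)=\frac{t^p}{p!}\bigl(\psi(a)+\gamma\bigr)+\frac{1}{(p-1)!}\sum_{k=0}^{p-1}(-1)^{k+1}\binom{p-1}{k}\,g(k,a)\,t^{p-k-1}-\frac{(-1)^p}{(p-1)!}\,g(p-1,a-t).$$ -/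

import Mathlib

/-- `Z` is the Hurwitz zeta function `s ↦ ζ(s, a)` with complex parameter `a`: it is given by the
Dirichlet-type series `∑_{n ≥ 0} (n + a)^{-s}` (principal powers) for `Re s > 1`, and it is
holomorphic on `ℂ ∖ {1}`. The value at the pole `s = 1` is left free and is never used. -/
def IsHurwitzContinuation (a : ℂ) (Z : ℂ → ℂ) : Prop :=
  DifferentiableOn ℂ Z {1}ᶜ ∧
    ∀ s : ℂ, 1 < s.re → HasSum (fun n : ℕ => 1 / ((n : ℂ) + a) ^ s) (Z s)

/-- The analytic continuation is unique away from `s = 1`, so that the choice made in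
`hurwitzZetaC` is immaterial. -/
theorem IsHurwitzContinuation.eqOn {a : ℂ} {Z W : ℂ → ℂ}
    (hZ : IsHurwitzContinuation a Z) (hW : IsHurwitzContinuation a W) :
    Set.EqOn Z W {1}ᶜ := by
  have hc : IsPreconnected ({1}ᶜ : Set ℂ) :=
    (isConnected_compl_singleton_of_one_lt_rank (by simp) 1).isPreconnected
  have ho : IsOpen ({1}ᶜ : Set ℂ) := isOpen_compl_singleton
  refine (hZ.1.analyticOnNhd ho).eqOn_of_preconnected_of_eventuallyEq
    (hW.1.analyticOnNhd ho) hc (z₀ := 2) (by simp) ?_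
  have h2 : {s : ℂ | 1 < s.re} ∈ nhds (2 : ℂ) :=
    (isOpen_lt continuous_const Complex.continuous_re).mem_nhds (by simp)
  filter_upwards [h2] with s hs
  exact (hZ.2 s hs).unique (hW.2 s hs)

open Classical in
/-- The Hurwitz zeta function `ζ(s, a)` for complex `a` (with `Re a > 0`): the analytic
continuation in `s` to `ℂ ∖ {1}` of `∑_{n ≥ 0} (n + a)^{-s}`. -/
noncomputable def hurwitzZetaC (s a : ℂ) : ℂ :=
  if h : ∃ Z : ℂ → ℂ, IsHurwitzContinuation a Z then h.choose s else 0

/-- `g(n, a) = ζ'(-n, a) + ψ(n + 1) ζ(-n, a)`, where `'` is the derivative in the first variable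
and `ψ` is the digamma function. -/
noncomputable def hurwitzG (n : ℕ) (a : ℂ) : ℂ :=
  deriv (fun s : ℂ => hurwitzZetaC s a) (-(n : ℂ))
    + Complex.digamma ((n : ℂ) + 1) * hurwitzZetaC (-(n : ℂ)) a

/-- The `n`-th term `ζ(n + 1, a) t^{n + p} / ((n + 1)(n + 2) ⋯ (n + p))` of the series
`T(t, a, p)`, which is summed over `n ≥ 1`. -/
noncomputable def seriesTTerm (t a : ℂ) (p n : ℕ) : ℂ :=
  hurwitzZetaC ((n : ℂ) + 1) a / (∏ j ∈ Finset.Icc 1 p, ((n : ℂ) + (j : ℂ))) * t ^ (n + p)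

/-- `T(t, a, p) = ∑_{n ≥ 1} ζ(n + 1, a) t^{n + p} / ((n + 1)(n + 2) ⋯ (n + p))`. -/
noncomputable def seriesT (t a : ℂ) (p : ℕ) : ℂ :=
  ∑' n : ℕ, seriesTTerm t a p (n + 1)

/-! For |t| < Re a, Taylor expansion in the parameter gives ζ(s, a - t) = ζ(s, a) + ∑_{k ≥ 0}
(s)_{k+1}/(k+1)! ζ(s+k+1, a) t^(k+1), valid for all s ≠ 1 once each summand is read as an entire
function of s. With m = p - 1, apply to it the functional f ↦ f'(-m) + ψ(m+1) f(-m), which turns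
ζ(·, a) into g(m, a). Three ranges of k appear. For k < m the logarithmic derivative of (s)_{k+1}
replaces ψ(m+1) by ψ(q+1), q = m - k - 1, giving a binomial multiple of g(q, a). For k = m the pole
of ζ meets the zero of (s)_{m+1}, and the constant term ψ(a) of the Laurent expansion yields ψ(a) +
γ. For k > m the zero remains, so only its derivative counts, and the summands are those of T. The
analytic input is that E(s) = (s - 1) ζ(s, a) is entire with E(1) = 1 and E'(1) = -ψ(a). This is
known for a = 1 and is carried to every a in the half-plane by integer shifts (`add_one`) and one
Taylor expansion (`sub`). -/

open Complex Filter Topology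

/-! ### Partial fractions of the digamma function -/

/-- The summands of the Weierstrass product of the Gamma function, on a logarithmic scale. -/
noncomputable def weierstrassTerm (n : ℕ) (y : ℂ) : ℂ :=
  y / ((n : ℂ) + 1) - log (1 + y / ((n : ℂ) + 1))

lemma hasDerivAt_weierstrassTerm (n : ℕ) {y : ℂ} (hy : -1 < y.re) :
    HasDerivAt (weierstrassTerm n) (y / (((n : ℂ) + 1) * ((n : ℂ) + 1 + y))) y := by
  have hn : (n : ℂ) + 1 ≠ 0 := Nat.cast_add_one_ne_zero n
  have hre : 0 < ((n : ℂ) + 1 + y).re := by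
    have : (0 : ℝ) ≤ n := n.cast_nonneg
    simp only [add_re, natCast_re, one_re]; linarith
  have hny : (n : ℂ) + 1 + y ≠ 0 := fun h => by rw [h] at hre; simp at hre
  have h1 : 1 + y / ((n : ℂ) + 1) = ((n : ℂ) + 1 + y) / (((n : ℝ) + 1 : ℝ) : ℂ) := by
    push_cast; field_simp
  have hs : 1 + y / ((n : ℂ) + 1) ∈ slitPlane := by
    left
    rw [h1, div_ofReal_re]
    positivity
  have hd : HasDerivAt (fun y : ℂ => y / ((n : ℂ) + 1)) (1 / ((n : ℂ) + 1)) y :=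
    (hasDerivAt_id y).div_const _
  refine (hd.sub ((hd.const_add 1).clog hs)).congr_deriv ?_
  rw [h1]
  push_cast
  field_simp
  ring

lemma summable_one_div_nat_add_one_sq (C : ℝ) :
    Summable fun n : ℕ => C / ((n : ℝ) + 1) ^ 2 := by
  have h := (summable_nat_add_iff 1).mpr (Real.summable_one_div_nat_pow.mpr one_lt_two)
  refine (h.mul_left C).congr fun n => ?_
  push_cast
  ring

lemma norm_weierstrassTerm_deriv_le (n : ℕ) {y : ℂ} {R : ℝ} (hy : -(1 / 2) < y.re)
    (hR : ‖y‖ ≤ R) :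
    ‖y / (((n : ℂ) + 1) * ((n : ℂ) + 1 + y))‖ ≤ 2 * R / ((n : ℝ) + 1) ^ 2 := by
  have hn : (0 : ℝ) ≤ n := n.cast_nonneg
  have h1 : ‖(n : ℂ) + 1‖ = (n : ℝ) + 1 := by
    rw [← Nat.cast_add_one, norm_natCast]; push_cast; ring
  have h2 : ((n : ℝ) + 1) / 2 ≤ ‖(n : ℂ) + 1 + y‖ := by
    refine le_trans ?_ (re_le_norm _)
    simp only [add_re, natCast_re, one_re]; linarith
  have hR0 : 0 ≤ R := (norm_nonneg y).trans hR
  rw [norm_div, norm_mul, h1, show 2 * R / ((n : ℝ) + 1) ^ 2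
    = R / (((n : ℝ) + 1) * (((n : ℝ) + 1) / 2)) by field_simp]
  gcongr

/-- The derivatives are O(n⁻²) uniformly on a convex set joining 0 to y, and every term vanishes at
0, so the series may be differentiated termwise. -/
lemma weierstrassTerm_tsum_aux {y : ℂ} (hy : -(1 / 2) < y.re) :
    Summable (fun n => weierstrassTerm n y) ∧
    HasDerivAt (fun y => ∑' n, weierstrassTerm n y)
      (∑' n : ℕ, y / (((n : ℂ) + 1) * ((n : ℂ) + 1 + y))) y := by
  set R := ‖y‖ + 1
  set U : Set ℂ := {z | -(1 / 2) < z.re} ∩ Metric.ball 0 R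
  have hU : IsOpen U := (isOpen_lt continuous_const continuous_re).inter Metric.isOpen_ball
  have hc : IsPreconnected U :=
    ((convex_halfSpace_re_gt _).inter (convex_ball _ _)).isPreconnected
  have h0 : (0 : ℂ) ∈ U := by
    refine ⟨by simp, ?_⟩
    simp only [Metric.mem_ball, dist_self, R]; positivity
  have hyU : y ∈ U := ⟨hy, by simp [R]⟩
  have hder : ∀ (n : ℕ) z, z ∈ U → HasDerivAt (weierstrassTerm n)
      (z / (((n : ℂ) + 1) * ((n : ℂ) + 1 + z))) z := fun n z hz =>
    hasDerivAt_weierstrassTerm n (by have := hz.1; simp only [Set.mem_ofPred_eq] at this; linarith)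
  have hb : ∀ (n : ℕ) z, z ∈ U → ‖z / (((n : ℂ) + 1) * ((n : ℂ) + 1 + z))‖
      ≤ 2 * R / ((n : ℝ) + 1) ^ 2 := fun n z hz =>
    norm_weierstrassTerm_deriv_le n hz.1 (by simpa using (Metric.mem_ball.mp hz.2).le)
  have hs0 : Summable fun n => weierstrassTerm n 0 := by
    simp [weierstrassTerm]
  exact ⟨summable_of_summable_hasDerivAt_of_isPreconnected (summable_one_div_nat_add_one_sq _)
    hU hc hder hb h0 hs0 hyU,
    hasDerivAt_tsum_of_isPreconnected (summable_one_div_nat_add_one_sq _) hU hc hder hb h0 hs0 hyU⟩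

/-- Inserting the factors exp(y/(j+1)) turns n^y into an exponential of log n minus the harmonic
number, whose limit supplies γ. -/
lemma GammaSeq_eq_exp {y : ℂ} (hy : 0 < y.re) {n : ℕ} (hn : n ≠ 0) :
    GammaSeq y n = exp (-y * (((harmonic n : ℚ) : ℝ) - Real.log n : ℝ)
      + ∑ j ∈ Finset.range n, weierstrassTerm j y) / y := by
  have hy0 : y ≠ 0 := fun h => by rw [h] at hy; simp at hy
  have hne : ∀ j : ℕ, y + (j + 1) ≠ 0 := fun j h => by
    have h1 := congrArg re h
    have : (0 : ℝ) ≤ j := j.cast_nonneg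
    simp only [add_re, natCast_re, one_re, zero_re] at h1; linarith
  have hexp : ∀ j : ℕ, exp (weierstrassTerm j y)
      = exp (y / (j + 1)) * ((j + 1) / (y + (j + 1))) := fun j => by
    have hj : (j : ℂ) + 1 ≠ 0 := Nat.cast_add_one_ne_zero j
    have h1 : 1 + y / ((j : ℂ) + 1) = (y + (j + 1)) / (j + 1) := by field_simp; ring
    rw [weierstrassTerm, exp_sub, h1, exp_log (div_ne_zero (hne j) hj)]
    field_simp
  have hprod : ∏ j ∈ Finset.range (n + 1), (y + j)
      = y * ∏ j ∈ Finset.range n, (y + (j + 1)) := by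
    rw [Finset.prod_range_succ', mul_comm]; simp
  have hfac : (n.factorial : ℂ) = ∏ j ∈ Finset.range n, ((j : ℂ) + 1) := by
    rw [← Finset.prod_range_add_one_eq_factorial]; push_cast; rfl
  have hharm : y * (((harmonic n : ℚ) : ℝ) : ℂ) = ∑ j ∈ Finset.range n, y / ((j : ℂ) + 1) := by
    rw [harmonic, Finset.sum_congr rfl fun j _ => div_eq_mul_inv y _, ← Finset.mul_sum]
    push_cast; rfl
  have hlog : (Real.log n : ℂ) = log n := by rw [ofReal_log (Nat.cast_nonneg n), ofReal_natCast]
  rw [GammaSeq, hprod, hfac, exp_add, exp_sum, Finset.prod_congr rfl fun j _ => hexp j,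
    Finset.prod_mul_distrib, ← exp_sum, ← hharm, Finset.prod_div_distrib, ofReal_sub, hlog,
    cpow_def_of_ne_zero (Nat.cast_ne_zero.mpr hn),
    show -y * ((((harmonic n : ℚ) : ℝ) : ℂ) - log n)
      = log n * y + -(y * (((harmonic n : ℚ) : ℝ) : ℂ)) by ring, exp_add, exp_neg]
  have h3 : ∏ j ∈ Finset.range n, (y + ((j : ℂ) + 1)) ≠ 0 :=
    Finset.prod_ne_zero_iff.mpr fun j _ => hne j
  have h4 := exp_ne_zero (y * (((harmonic n : ℚ) : ℝ) : ℂ))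
  field_simp

lemma Gamma_eq_exp_tsum {y : ℂ} (hy : 0 < y.re) :
    Gamma y = exp (-y * Real.eulerMascheroniConstant + ∑' n, weierstrassTerm n y) / y := by
  have h1 : Tendsto (fun n : ℕ => ((((harmonic n : ℚ) : ℝ) - Real.log n : ℝ) : ℂ)) atTop
      (𝓝 (Real.eulerMascheroniConstant : ℂ)) :=
    (continuous_ofReal.tendsto _).comp Real.tendsto_harmonic_sub_log
  have h2 := (weierstrassTerm_tsum_aux (y := y) (by linarith)).1.hasSum.tendsto_sum_nat
  have h3 := ((continuous_exp.tendsto _).comp ((h1.const_mul (-y)).add h2)).div_const y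
  refine tendsto_nhds_unique (GammaSeq_tendsto_Gamma y) (h3.congr' ?_)
  filter_upwards [eventually_ne_atTop 0] with n hn
  rw [GammaSeq_eq_exp hy hn]
  rfl

theorem digamma_eq_tsum {y : ℂ} (hy : 0 < y.re) :
    digamma y = (∑' n : ℕ, y / (((n : ℂ) + 1) * ((n : ℂ) + 1 + y)))
      - Real.eulerMascheroniConstant - 1 / y := by
  have hy0 : y ≠ 0 := fun h => by rw [h] at hy; simp at hy
  have hd := (weierstrassTerm_tsum_aux (y := y) (by linarith)).2
  have h1 := ((((hasDerivAt_id y).neg.mul_const (Real.eulerMascheroniConstant : ℂ)).add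
    hd).cexp.div (hasDerivAt_id y) hy0)
  have he : Gamma =ᶠ[𝓝 y] fun y =>
      exp (-y * Real.eulerMascheroniConstant + ∑' n, weierstrassTerm n y) / y := by
    filter_upwards [(isOpen_lt continuous_const continuous_re).mem_nhds hy] with z hz
    exact Gamma_eq_exp_tsum hz
  have h2 := he.deriv_eq.trans h1.deriv
  rw [digamma_def, logDeriv_apply, h2, Gamma_eq_exp_tsum hy]
  have h4 := exp_ne_zero (-y * Real.eulerMascheroniConstant + ∑' n, weierstrassTerm n y)
  simp only [id, Pi.neg_apply, Pi.add_apply]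
  field_simp
  ring

/-- The partial fraction expansion of the difference of two values of the digamma function. -/
theorem hasSum_digamma_sub {a b : ℂ} (ha : 0 < a.re) (hb : 0 < b.re) :
    HasSum (fun n : ℕ => 1 / ((n : ℂ) + b) - 1 / ((n : ℂ) + a)) (digamma a - digamma b) := by
  have hsum : ∀ {y : ℂ}, 0 < y.re →
      HasSum (fun n : ℕ => y / (((n : ℂ) + 1) * ((n : ℂ) + 1 + y)))
        (digamma y + Real.eulerMascheroniConstant + 1 / y) := fun {y} hy => by
    have hs : Summable (fun n : ℕ => y / (((n : ℂ) + 1) * ((n : ℂ) + 1 + y))) :=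
      Summable.of_norm_bounded (summable_one_div_nat_add_one_sq (2 * ‖y‖))
        fun n => norm_weierstrassTerm_deriv_le n (by linarith) le_rfl
    convert hs.hasSum using 1
    rw [digamma_eq_tsum hy]; ring
  have hne : ∀ {y : ℂ}, 0 < y.re → ∀ n : ℕ, (n : ℂ) + 1 + y ≠ 0 := fun {y} hy n h => by
    have h1 := congrArg re h
    have : (0 : ℝ) ≤ n := n.cast_nonneg
    simp only [add_re, natCast_re, one_re, zero_re] at h1; linarith
  -- The n = 0 term is split off: it accounts for the -1/y in the expansion of ψ(y).
  rw [← hasSum_nat_add_iff' 1]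
  convert (hsum ha).sub (hsum hb) using 1
  · ext n
    have hn : (n : ℂ) + 1 ≠ 0 := Nat.cast_add_one_ne_zero n
    have h1 := hne ha n
    have h2 := hne hb n
    push_cast
    field_simp
    ring
  · simp; ring

/-! ### Binomial series and bounds for the Dirichlet series -/

lemma natCast_add_ne_zero_of_re_pos {a : ℂ} (ha : 0 < a.re) (n : ℕ) : (n : ℂ) + a ≠ 0 := by
  intro h
  have h1 := congrArg re h
  have : (0 : ℝ) ≤ n := n.cast_nonneg
  simp only [add_re, natCast_re, zero_re] at h1
  linarith

lemma le_norm_natCast_add {a : ℂ} (n : ℕ) : (n : ℝ) + a.re ≤ ‖(n : ℂ) + a‖ := by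
  simpa using re_le_norm ((n : ℂ) + a)

lemma re_le_norm_natCast_add {a : ℂ} (n : ℕ) : a.re ≤ ‖(n : ℂ) + a‖ := by
  have : (0 : ℝ) ≤ n := n.cast_nonneg
  linarith [le_norm_natCast_add (a := a) n]

/-- The binomial series, with coefficients written as rising factorials. -/
theorem hasSum_one_div_one_sub_cpow (s : ℂ) {z : ℂ} (hz : ‖z‖ < 1) :
    HasSum (fun k : ℕ => (ascPochhammer ℂ k).eval s / (k.factorial : ℂ) * z ^ k)
      (1 / (1 - z) ^ s) := by
  have h := (one_div_one_sub_cpow_hasFPowerSeriesOnBall_zero s).hasSum (y := z)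
    (by simpa [Metric.mem_eball, edist_zero_right, enorm_eq_nnnorm, ← NNReal.coe_lt_coe] using hz)
  simp only [FormalMultilinearSeries.ofScalars_apply_eq, zero_add, smul_eq_mul] at h
  refine h.congr_fun fun k => ?_
  rw [← Ring.multichoose_eq]
  have h1 := Ring.factorial_nsmul_multichoose_eq_ascPochhammer s k
  rw [Polynomial.ascPochhammer_smeval_eq_eval, nsmul_eq_mul] at h1
  rw [← h1, mul_div_cancel_left₀ _ (Nat.cast_ne_zero.mpr k.factorial_ne_zero)]

/-- Both arguments lie in (-π/2, π/2), so their sum stays on the principal branch. -/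
lemma mul_cpow_of_re_pos {z w : ℂ} (hz : 0 < z.re) (hw : 0 < w.re) (s : ℂ) :
    (z * w) ^ s = z ^ s * w ^ s := by
  have hz0 : z ≠ 0 := fun h => by simp [h] at hz
  have hw0 : w ≠ 0 := fun h => by simp [h] at hw
  have h1 := abs_lt.mp (abs_arg_lt_pi_div_two_iff.mpr (Or.inl hz))
  have h2 := abs_lt.mp (abs_arg_lt_pi_div_two_iff.mpr (Or.inl hw))
  rw [cpow_def_of_ne_zero (mul_ne_zero hz0 hw0), cpow_def_of_ne_zero hz0,
    cpow_def_of_ne_zero hw0,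
    (log_mul_eq_add_log_iff hz0 hw0).mpr ⟨by linarith [h1.1, h2.1], by linarith [h1.2, h2.2]⟩,
    add_mul, exp_add]

theorem hasSum_one_div_sub_cpow (s : ℂ) {w t : ℂ} (hw : 0 < w.re) (ht : ‖t‖ < ‖w‖) :
    HasSum (fun k : ℕ => (ascPochhammer ℂ k).eval s / (k.factorial : ℂ) * t ^ k / w ^ (s + k))
      (1 / (w - t) ^ s) := by
  have hw0 : w ≠ 0 := fun h => by simp [h] at hw
  have htw : ‖t / w‖ < 1 := by
    rw [norm_div]
    exact (div_lt_one (norm_pos_iff.mpr hw0)).mpr ht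
  have hre : 0 < (1 - t / w).re := by
    have := (re_le_norm (t / w)).trans_lt htw
    simp only [sub_re, one_re]; linarith
  have h := (hasSum_one_div_one_sub_cpow s htw).mul_left (1 / w ^ s)
  have h2 : w - t = w * (1 - t / w) := by field_simp
  rw [h2, mul_cpow_of_re_pos hw hre, one_div_mul_one_div] at *
  refine h.congr_fun fun k => ?_
  rw [cpow_add _ _ hw0, cpow_natCast, div_pow]
  field_simp

lemma norm_ascPochhammer_eval_le {s : ℂ} {R : ℕ} (hs : ‖s‖ ≤ R) (k : ℕ) :
    ‖(ascPochhammer ℂ k).eval s‖ ≤ R.ascFactorial k := by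
  induction k with
  | zero => simp
  | succ k ih =>
    rw [ascPochhammer_succ_eval, norm_mul, Nat.ascFactorial_succ, mul_comm (R + k)]
    push_cast
    have : ‖s + k‖ ≤ R + k := (norm_add_le _ _).trans (by simpa using hs)
    gcongr

lemma norm_ascPochhammer_eval_div_factorial_le {s : ℂ} {R : ℕ} (hs : ‖s‖ ≤ R + 1) (k : ℕ) :
    ‖(ascPochhammer ℂ k).eval s / (k.factorial : ℂ)‖ ≤ (k + R).choose R := by
  have h1 := norm_ascPochhammer_eval_le (R := R + 1) (by exact_mod_cast hs) k
  rw [Nat.ascFactorial_eq_factorial_mul_choose, add_comm R k, Nat.choose_symm_add] at h1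
  rw [norm_div, norm_natCast, div_le_iff₀ (by positivity), mul_comm]
  exact_mod_cast h1

lemma norm_one_div_cpow_le {z s : ℂ} (hz : z ≠ 0) :
    ‖1 / z ^ s‖ ≤ Real.exp (Real.pi * |s.im|) / ‖z‖ ^ s.re := by
  have h : arg z * s.im ≤ Real.pi * |s.im| :=
    calc arg z * s.im ≤ |arg z * s.im| := le_abs_self _
      _ = |arg z| * |s.im| := abs_mul _ _
      _ ≤ _ := by gcongr; exact abs_arg_le_pi z
  rw [norm_div, norm_one, norm_cpow_of_ne_zero hz, one_div_div]
  exact div_le_div_of_nonneg_right (Real.exp_le_exp.mpr h) (by positivity)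

lemma summable_one_div_natCast_add_rpow {r x : ℝ} (hr : 0 < r) (hx : 1 < x) :
    Summable fun n : ℕ => 1 / ((n : ℝ) + r) ^ x := by
  refine ((Real.summable_one_div_nat_add_rpow r x).mpr hx).congr fun n => ?_
  rw [abs_of_pos (by positivity)]

lemma summable_norm_one_div_natCast_add_cpow {a s : ℂ} (ha : 0 < a.re) (hs : 1 < s.re) :
    Summable fun n : ℕ => ‖1 / ((n : ℂ) + a) ^ s‖ := by
  refine Summable.of_nonneg_of_le (fun _ => norm_nonneg _) (fun n => ?_)
    ((summable_one_div_natCast_add_rpow ha hs).mul_left (Real.exp (Real.pi * |s.im|)))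
  refine (norm_one_div_cpow_le (natCast_add_ne_zero_of_re_pos ha n)).trans ?_
  rw [mul_one_div]
  have : (0 : ℝ) ≤ n := n.cast_nonneg
  gcongr
  exact le_norm_natCast_add n

lemma norm_one_div_cpow_add_natCast_le {a : ℂ} (ha : 0 < a.re) (s : ℂ) (n j : ℕ) :
    ‖1 / ((n : ℂ) + a) ^ (s + j)‖ ≤ ‖1 / ((n : ℂ) + a) ^ s‖ * (1 / a.re ^ j) := by
  have h0 := natCast_add_ne_zero_of_re_pos ha n
  rw [cpow_add _ _ h0, cpow_natCast, ← one_div_mul_one_div, norm_mul, norm_div _ (_ ^ j), norm_pow,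
    norm_one]
  gcongr
  exact re_le_norm_natCast_add n

/-- The Dirichlet series of the Hurwitz zeta function is bounded uniformly in vertical rectangles
to the right of `Re s = 1`. -/
lemma exists_summable_norm_one_div_cpow_le {a : ℂ} (ha : 0 < a.re) {M : ℝ} (hM0 : 0 ≤ M) :
    ∃ u : ℕ → ℝ, Summable u ∧ ∀ s : ℂ, 2 ≤ s.re → ‖s‖ ≤ M → ∀ n : ℕ,
      ‖1 / ((n : ℂ) + a) ^ s‖ ≤ u n := by
  refine ⟨fun n => Real.exp (Real.pi * M) * (1 / ((n : ℝ) + a.re) ^ (2 : ℝ)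
    + 1 / ((n : ℝ) + a.re) ^ (M + 2)), ?_, fun s hs hM n => ?_⟩
  · exact ((summable_one_div_natCast_add_rpow ha one_lt_two).add
      (summable_one_div_natCast_add_rpow ha (by linarith))).mul_left _
  · refine (norm_one_div_cpow_le (natCast_add_ne_zero_of_re_pos ha n)).trans ?_
    have hn : (0 : ℝ) < n + a.re := by positivity
    have h1 : Real.exp (Real.pi * |s.im|) / ‖(n : ℂ) + a‖ ^ s.re
        ≤ Real.exp (Real.pi * M) / ((n : ℝ) + a.re) ^ s.re := by
      gcongr
      · exact (abs_im_le_norm s).trans hM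
      · exact le_norm_natCast_add n
    refine h1.trans ?_
    rw [div_eq_mul_one_div]
    refine mul_le_mul_of_nonneg_left ?_ (Real.exp_nonneg _)
    -- Since 2 ≤ Re s ≤ M + 2, the power is controlled by the smaller exponent when the base is at
    -- least 1 and by the larger one otherwise.
    rcases le_total 1 ((n : ℝ) + a.re) with h | h
    · refine le_add_of_le_of_nonneg ?_ (by positivity)
      exact one_div_le_one_div_of_le (by positivity) (Real.rpow_le_rpow_of_exponent_le h hs)
    · refine le_add_of_nonneg_of_le (by positivity) ?_
      have : s.re ≤ M + 2 := by linarith [(re_le_norm s).trans hM]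
      exact one_div_le_one_div_of_le (by positivity)
        (Real.rpow_le_rpow_of_exponent_ge hn h this)

/-! ### Taylor expansion of ζ(s, a) in the parameter -/

/-- `E` is the entire function `s ↦ (s - 1) ζ(s, a)`, normalised by its value and its derivative
at `s = 1`. -/
structure IsRegularizedHurwitz (a : ℂ) (E : ℂ → ℂ) : Prop where
  differentiable : Differentiable ℂ E
  hasSum : ∀ s : ℂ, 1 < s.re → HasSum (fun n : ℕ => 1 / ((n : ℂ) + a) ^ s) (E s / (s - 1))
  apply_one : E 1 = 1
  deriv_one : deriv E 1 = -digamma a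

/-- The `(k + 1)`-st term `(s)_{k+1} / (k+1)! ζ(s + k + 1, a) t ^ (k + 1)` of the Taylor series of
`t ↦ ζ(s, a - t)`, as an entire function of `s`. -/
noncomputable def hurwitzTaylorTerm (E : ℂ → ℂ) (t : ℂ) (k : ℕ) (s : ℂ) : ℂ :=
  (ascPochhammer ℂ k).eval s / ((k + 1).factorial : ℂ) * E (s + k + 1) * t ^ (k + 1)

/-- The last factor s + k of (s)_{k+1} cancels the pole of ζ(s+k+1, a); hence the shorter Pochhammer
symbol in the definition. -/
lemma hurwitzTaylorTerm_eq (E : ℂ → ℂ) (t : ℂ) {k : ℕ} {s : ℂ} (hs : s + k ≠ 0) :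
    hurwitzTaylorTerm E t k s = (ascPochhammer ℂ (k + 1)).eval s / ((k + 1).factorial : ℂ)
      * (E (s + k + 1) / (s + k)) * t ^ (k + 1) := by
  rw [hurwitzTaylorTerm, ascPochhammer_succ_eval]
  field_simp

lemma differentiable_hurwitzTaylorTerm {E : ℂ → ℂ} (hE : Differentiable ℂ E) (t : ℂ) (k : ℕ) :
    Differentiable ℂ (hurwitzTaylorTerm E t k) := by
  unfold hurwitzTaylorTerm
  have := (ascPochhammer ℂ k).differentiable
  fun_prop

lemma exists_summable_bound_of_tail {F : ℕ → ℂ → ℂ} {B : Set ℂ} (hB : IsCompact B)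
    (hF : ∀ k, ContinuousOn (F k) B) (K : ℕ) {v : ℕ → ℝ} (hv : Summable v)
    (hFv : ∀ k, ∀ s ∈ B, ‖F (k + K) s‖ ≤ v k) :
    ∃ u : ℕ → ℝ, Summable u ∧ ∀ k, ∀ s ∈ B, ‖F k s‖ ≤ u k := by
  choose C hC using fun k => hB.exists_bound_of_continuousOn (hF k)
  refine ⟨fun k => if k < K then C k else v (k - K), ?_, fun k s hs => ?_⟩
  · rw [← summable_nat_add_iff K]
    simpa using hv
  · dsimp only
    split_ifs with h
    · exact hC k s hs
    · have := hFv (k - K) s hs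
      rwa [Nat.sub_add_cancel (not_lt.mp h)] at this

lemma summable_choose_mul_div_pow {x r : ℝ} (hx : 0 ≤ x) (hxr : x < r) (R m : ℕ) :
    Summable fun k : ℕ => ((k + m + R).choose R : ℝ) * (x / r) ^ (k + m) := by
  have hr : ‖x / r‖ < 1 := by
    rw [Real.norm_of_nonneg (div_nonneg hx (hx.trans hxr.le))]
    exact (div_lt_one (hx.trans_lt hxr)).mpr hxr
  exact (summable_nat_add_iff (f := fun n : ℕ => ((n + R).choose R : ℝ) * (x / r) ^ n) m).mpr
    (summable_choose_mul_geometric_of_norm_lt_one R hr)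

namespace IsRegularizedHurwitz

variable {a t : ℂ} {E : ℂ → ℂ}

/-- On a disc all but finitely many arguments s + k + 1 have real part at least 2. There the
Dirichlet series decays like (Re a)^(-k), and the coefficients grow polynomially in k, so the ratio
|t|/Re a < 1 decides. -/
lemma exists_summable_bound (hE : IsRegularizedHurwitz a E) (ha : 0 < a.re) (ht : ‖t‖ < a.re)
    (R : ℕ) : ∃ u : ℕ → ℝ, Summable u ∧ ∀ k, ∀ s ∈ Metric.closedBall (0 : ℂ) (R + 1),
      ‖hurwitzTaylorTerm E t k s‖ ≤ u k := by
  obtain ⟨c, hc, hcb⟩ := exists_summable_norm_one_div_cpow_le ha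
    (M := (R + 1 : ℝ) + (R + 3)) (by positivity)
  refine exists_summable_bound_of_tail (isCompact_closedBall _ _)
    (fun k => (differentiable_hurwitzTaylorTerm hE.differentiable t k).continuous.continuousOn)
    (R + 2) (v := fun k => ((k + (R + 3) + R).choose R : ℝ) * (‖t‖ / a.re) ^ (k + (R + 3))
      * ((∑' n, c n) * a.re ^ (R + 3)))
    ((summable_choose_mul_div_pow (norm_nonneg t) ht R (R + 3)).mul_right _) fun k s hs => ?_
  have hs' : ‖s‖ ≤ R + 1 := by simpa using hs
  have hre : -(R + 1 : ℝ) ≤ s.re := by linarith [(abs_le.mp ((abs_re_le_norm s).trans hs')).1]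
  -- Re s ≥ -(R + 1), so the shift R + 3 is what brings the real part up to 2.
  set w : ℂ := s + (R + 3 : ℕ) with hw
  have hw2 : 2 ≤ w.re := by
    rw [hw, add_re, natCast_re]; push_cast; linarith
  have hwM : ‖w‖ ≤ (R + 1 : ℝ) + (R + 3) := by
    refine (norm_add_le _ _).trans (add_le_add hs' ?_)
    rw [norm_natCast]; push_cast; exact le_rfl
  have hsk : s + ((k + (R + 2) : ℕ) : ℂ) ≠ 0 := by
    intro h
    have h1 := congrArg re h
    have : (0 : ℝ) ≤ k := k.cast_nonneg
    rw [add_re, natCast_re, zero_re] at h1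
    push_cast at h1
    linarith
  have hwk : s + ((k + (R + 2) : ℕ) : ℂ) + 1 = w + k := by rw [hw]; push_cast; ring
  have hwk' : s + ((k + (R + 2) : ℕ) : ℂ) = w + k - 1 := by rw [hw]; push_cast; ring
  have hZ : ‖E (w + k) / (w + k - 1)‖ ≤ (∑' n, c n) * (1 / a.re ^ k) := by
    have h1 : 1 < (w + k).re := by
      have : (0 : ℝ) ≤ k := k.cast_nonneg
      rw [add_re, natCast_re]; linarith
    refine (hE.hasSum (w + k) h1).norm_le_of_bounded (hc.hasSum.mul_right _) fun n => ?_
    refine (norm_one_div_cpow_add_natCast_le ha w n k).trans ?_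
    gcongr
    exact hcb w hw2 hwM n
  rw [hurwitzTaylorTerm_eq E t hsk, hwk, hwk', norm_mul, norm_mul, norm_pow]
  calc _ ≤ ((k + (R + 2) + 1 + R).choose R : ℝ) * ((∑' n, c n) * (1 / a.re ^ k))
        * ‖t‖ ^ (k + (R + 2) + 1) := by
        gcongr
        exact norm_ascPochhammer_eval_div_factorial_le hs' _
    _ = _ := by
        rw [show k + (R + 2) + 1 = k + (R + 3) by ring, div_pow, pow_add a.re k (R + 3)]
        field_simp

lemma hurwitzTaylorTerm_aux (hE : IsRegularizedHurwitz a E) (ha : 0 < a.re) (ht : ‖t‖ < a.re)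
    (s : ℂ) :
    HasSum (fun k => hurwitzTaylorTerm E t k s) (∑' k, hurwitzTaylorTerm E t k s) ∧
    HasSum (fun k => deriv (hurwitzTaylorTerm E t k) s)
      (deriv (fun s => ∑' k, hurwitzTaylorTerm E t k s) s) ∧
    DifferentiableAt ℂ (fun s => ∑' k, hurwitzTaylorTerm E t k s) s := by
  obtain ⟨R, hR⟩ := exists_nat_ge ‖s‖
  obtain ⟨u, hu, hb⟩ := hE.exists_summable_bound ha ht R
  have hb' : ∀ k, ∀ w ∈ Metric.ball (0 : ℂ) (R + 1), ‖hurwitzTaylorTerm E t k w‖ ≤ u k :=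
    fun k w hw => hb k w (Metric.ball_subset_closedBall hw)
  have hs : s ∈ Metric.ball (0 : ℂ) (R + 1) := by
    rw [mem_ball_zero_iff]; linarith
  have hd : ∀ k, DifferentiableOn ℂ (hurwitzTaylorTerm E t k) (Metric.ball (0 : ℂ) (R + 1)) :=
    fun k => (differentiable_hurwitzTaylorTerm hE.differentiable t k).differentiableOn
  exact ⟨(Summable.of_norm_bounded hu fun k => hb' k s hs).hasSum,
    hasSum_deriv_of_summable_norm hu hd Metric.isOpen_ball hb' hs,
    (differentiableOn_tsum_of_summable_norm hu hd Metric.isOpen_ball hb').differentiableAt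
      (Metric.isOpen_ball.mem_nhds hs)⟩

/-- For `Re s > 0` the Taylor series of `ζ(s, a - t) - ζ(s, a)` agrees with the difference of the
Dirichlet series. -/
lemma hasSum_sub (hE : IsRegularizedHurwitz a E) (ha : 0 < a.re) (ht : ‖t‖ < a.re)
    {s : ℂ} (hs : 0 < s.re) :
    HasSum (fun n : ℕ => 1 / ((n : ℂ) + (a - t)) ^ s - 1 / ((n : ℂ) + a) ^ s)
      (∑' k, hurwitzTaylorTerm E t k s) := by
  obtain ⟨R, hR⟩ := exists_nat_ge ‖s‖
  set c : ℕ → ℂ := fun k =>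
    (ascPochhammer ℂ (k + 1)).eval s / ((k + 1).factorial : ℂ) * t ^ (k + 1) with hc
  -- This double series converges absolutely because Re (s + 1) > 1; summing over k first gives the
  -- differences, summing over n first the Taylor terms.
  set f : ℕ × ℕ → ℂ := fun p => c p.2 * (1 / ((p.1 : ℂ) + a) ^ (s + 1 + p.2)) with hf
  have hfs : Summable f := by
    have h1 := summable_norm_one_div_natCast_add_cpow (s := s + 1) ha
      (by simpa using hs)
    have h2 := (summable_choose_mul_div_pow (norm_nonneg t) ht R 1).mul_right a.re
    refine Summable.of_norm_bounded (h1.mul_of_nonneg h2 (fun _ => norm_nonneg _)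
      fun k => by simp only [Pi.zero_apply]; positivity) fun p => ?_
    rw [hf, hc, norm_mul, norm_mul, norm_pow]
    calc _ ≤ ((p.2 + 1 + R).choose R : ℝ) * ‖t‖ ^ (p.2 + 1)
          * (‖1 / ((p.1 : ℂ) + a) ^ (s + 1)‖ * (1 / a.re ^ p.2)) := by
          gcongr
          · exact norm_ascPochhammer_eval_div_factorial_le (by linarith) _
          · exact norm_one_div_cpow_add_natCast_le ha _ _ _
      _ = _ := by rw [div_pow, pow_succ a.re]; field_simp
  have hrow : ∀ n : ℕ, HasSum (fun k => f (n, k))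
      (1 / ((n : ℂ) + (a - t)) ^ s - 1 / ((n : ℂ) + a) ^ s) := fun n => by
    have hw : 0 < ((n : ℂ) + a).re := by rw [add_re, natCast_re]; positivity
    have h := hasSum_one_div_sub_cpow s hw (ht.trans_le (re_le_norm_natCast_add n))
    rw [← hasSum_nat_add_iff' 1] at h
    convert! h using 1
    · ext k
      rw [hf, hc]
      push_cast
      rw [show s + ((k : ℂ) + 1) = s + 1 + k by ring]
      ring
    · simp [add_sub_assoc]
  have hcol : ∀ k : ℕ, HasSum (fun n => f (n, k)) (hurwitzTaylorTerm E t k s) := fun k => by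
    have hk : (0 : ℝ) ≤ k := k.cast_nonneg
    have hsk : s + k ≠ 0 := fun h => by
      have h1 := congrArg re h
      rw [add_re, natCast_re, zero_re] at h1
      linarith
    have h := (hE.hasSum (s + 1 + k) (by
      simp only [add_re, one_re, natCast_re]; linarith)).mul_left (c k)
    convert! h using 1
    rw [hurwitzTaylorTerm_eq E t hsk, hc, show s + 1 + (k : ℂ) = s + k + 1 by ring]
    ring
  have h1 := hfs.hasSum.prod_fiberwise hrow
  have h2 := ((Equiv.prodComm ℕ ℕ).hasSum_iff.mpr hfs.hasSum).prod_fiberwise hcol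
  rwa [h2.tsum_eq]

/-- Passage from `ζ(s, a)` to `ζ(s, a - t)`. -/
theorem sub (hE : IsRegularizedHurwitz a E) (ha : 0 < a.re) (ht : ‖t‖ < a.re) :
    IsRegularizedHurwitz (a - t)
      (fun s => E s + (s - 1) * ∑' k, hurwitzTaylorTerm E t k s) := by
  have hS : Differentiable ℂ fun s => ∑' k, hurwitzTaylorTerm E t k s :=
    fun s => (hE.hurwitzTaylorTerm_aux ha ht s).2.2
  have hat : 0 < (a - t).re := by
    rw [sub_re]; linarith [re_le_norm t]
  refine ⟨?_, fun s hs => ?_, by simp [hE.apply_one], ?_⟩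
  · exact hE.differentiable.add ((differentiable_id.sub_const 1).mul hS)
  · have hs1 : s - 1 ≠ 0 := fun h => by
      rw [sub_eq_zero.mp h] at hs; simp at hs
    convert! (hE.hasSum s hs).add (hE.hasSum_sub ha ht (by linarith)) using 1
    · ext n; ring
    · field_simp
  -- The factor s - 1 leaves only the value of the Taylor sum at s = 1, where `hasSum_sub` still
  -- applies and gives ψ(a) - ψ(a - t).
  · have h1 := (hE.differentiable 1).hasDerivAt.add
      (((hasDerivAt_id (1 : ℂ)).sub_const 1).mul (hS 1).hasDerivAt)
    have h2 := hE.hasSum_sub ha ht (s := 1) (by simp)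
    simp only [cpow_one] at h2
    have h3 := h2.unique (hasSum_digamma_sub ha hat)
    refine h1.deriv.trans ?_
    rw [hE.deriv_one, h3]
    simp only [id, sub_self, zero_mul, add_zero, one_mul]
    ring

/-- Passage from `ζ(s, a)` to `ζ(s, a + 1)`. -/
theorem add_one (hE : IsRegularizedHurwitz a E) (ha : 0 < a.re) :
    IsRegularizedHurwitz (a + 1) (fun s => E s - (s - 1) * (1 / a ^ s)) := by
  have ha0 : a ≠ 0 := fun h => by simp [h] at ha
  have hd : Differentiable ℂ fun s : ℂ => 1 / a ^ s := by
    have h : ∀ s : ℂ, a ^ s ≠ 0 := fun s => by simp [cpow_eq_zero_iff, ha0]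
    exact (differentiable_const 1).div
      (differentiable_id.const_cpow (Or.inl ha0)) h
  refine ⟨?_, fun s hs => ?_, by simp [hE.apply_one], ?_⟩
  · exact hE.differentiable.sub ((differentiable_id.sub_const 1).mul hd)
  · have hs1 : s - 1 ≠ 0 := fun h => by
      rw [sub_eq_zero.mp h] at hs; simp at hs
    have h := hE.hasSum s hs
    rw [← hasSum_nat_add_iff' 1] at h
    convert! h using 1
    · ext n
      push_cast
      rw [add_assoc, add_comm 1 a]
    · simp; field_simp
  · have h1 := (hE.differentiable 1).hasDerivAt.sub
      (((hasDerivAt_id (1 : ℂ)).sub_const 1).mul (hd 1).hasDerivAt)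
    refine h1.deriv.trans ?_
    rw [hE.deriv_one, digamma_apply_add_one]
    · simp; ring
    · intro m h
      rw [h] at ha
      have : (0 : ℝ) ≤ m := m.cast_nonneg
      simp at ha
      linarith

end IsRegularizedHurwitz

/-! ### Existence of the continuation for Re a > 0 -/

lemma isRegularizedHurwitz_one : IsRegularizedHurwitz 1 riemannZeta₁ where
  differentiable := differentiable_riemannZeta₁
  apply_one := riemannZeta₁_one
  deriv_one := by rw [deriv_riemannZeta₁_one, digamma_one, neg_neg]
  hasSum s hs := by
    have hs1 : s ≠ 1 := fun h => by simp [h] at hs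
    have h := summable_norm_one_div_natCast_add_cpow (a := 1) (by simp) hs
    convert! (Summable.of_norm h).hasSum using 1
    rw [← zeta_eq_tsum_one_div_nat_add_one_cpow hs, riemannZeta_eq_inv_sub_mul hs1]
    ring

lemma exists_isRegularizedHurwitz_natCast_add_one (N : ℕ) :
    ∃ E, IsRegularizedHurwitz ((N : ℂ) + 1) E := by
  induction N with
  | zero => exact ⟨_, by simpa using isRegularizedHurwitz_one⟩
  | succ N ih =>
    obtain ⟨E, hE⟩ := ih
    have hN : 0 < ((N : ℂ) + 1).re := by
      have : (0 : ℝ) ≤ N := N.cast_nonneg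
      simp only [add_re, natCast_re, one_re]; linarith
    exact ⟨_, by simpa only [Nat.cast_succ] using hE.add_one hN⟩

theorem exists_isRegularizedHurwitz {a : ℂ} (ha : 0 < a.re) :
    ∃ E, IsRegularizedHurwitz a E := by
  -- The condition |N + 1 - a| < N + 1 amounts to |a|² < 2 (N + 1) Re a, so a lies in the disc of
  -- expansion about N + 1.
  obtain ⟨N, hN⟩ := exists_nat_gt (‖a‖ ^ 2 / (2 * a.re))
  obtain ⟨E, hE⟩ := exists_isRegularizedHurwitz_natCast_add_one N
  have hN0 : (0 : ℝ) ≤ N := N.cast_nonneg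
  have hb : 0 < ((N : ℂ) + 1).re := by
    simp only [add_re, natCast_re, one_re]; linarith
  have ht : ‖(N : ℂ) + 1 - a‖ < ((N : ℂ) + 1).re := by
    rw [div_lt_iff₀ (by positivity)] at hN
    refine lt_of_pow_lt_pow_left₀ 2 hb.le ?_
    rw [← normSq_eq_norm_sq, normSq_apply] at *
    simp only [add_re, natCast_re, one_re, sub_re, sub_im, add_im, natCast_im, one_im]
    nlinarith
  refine ⟨_, by simpa using hE.sub hb ht⟩

lemma IsRegularizedHurwitz.hurwitzZetaC_eq {a : ℂ} {E : ℂ → ℂ} (hE : IsRegularizedHurwitz a E)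
    {s : ℂ} (hs : s ≠ 1) : hurwitzZetaC s a = E s / (s - 1) := by
  have hZ : IsHurwitzContinuation a fun s => E s / (s - 1) :=
    ⟨hE.differentiable.differentiableOn.div (by fun_prop) fun s hs => sub_ne_zero.mpr hs, hE.hasSum⟩
  have h : ∃ Z : ℂ → ℂ, IsHurwitzContinuation a Z := ⟨_, hZ⟩
  rw [hurwitzZetaC, dif_pos h]
  exact h.choose_spec.eqOn hZ hs

lemma IsRegularizedHurwitz.differentiableAt_hurwitzZetaC {a : ℂ} {E : ℂ → ℂ}
    (hE : IsRegularizedHurwitz a E) {s : ℂ} (hs : s ≠ 1) :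
    DifferentiableAt ℂ (fun s => hurwitzZetaC s a) s := by
  have h : DifferentiableAt ℂ (fun s => E s / (s - 1)) s :=
    (hE.differentiable s).div (by fun_prop) (sub_ne_zero.mpr hs)
  refine h.congr_of_eventuallyEq ?_
  filter_upwards [isOpen_ne.mem_nhds hs] with z hz
  exact hE.hurwitzZetaC_eq hz

/-! ### Pochhammer symbols near a nonpositive integer -/

lemma neg_natCast_ne_one (m : ℕ) : -(m : ℂ) ≠ 1 := by
  intro h
  have h1 := congrArg re h
  have : (0 : ℝ) ≤ m := m.cast_nonneg
  rw [neg_re, natCast_re, one_re] at h1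
  linarith

lemma digamma_natCast_add_two (q : ℕ) :
    digamma ((q : ℂ) + 1 + 1) = digamma ((q : ℂ) + 1) + ((q : ℂ) + 1)⁻¹ := by
  refine digamma_apply_add_one _ fun m h => ?_
  have h1 := congrArg re h
  have : (0 : ℝ) ≤ m := m.cast_nonneg
  have : (0 : ℝ) ≤ q := q.cast_nonneg
  simp only [neg_re, natCast_re, add_re, one_re] at h1
  linarith

lemma ascPochhammer_eval_neg_natCast_mul_factorial (k : ℕ) : ∀ {m q : ℕ}, m = k + q →
    (ascPochhammer ℂ k).eval (-(m : ℂ)) * (q.factorial : ℂ) = (-1) ^ k * (m.factorial : ℂ) := by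
  induction k with
  | zero => rintro m q rfl; simp
  | succ k ih =>
    intro m q h
    have h1 := ih (m := m) (q := q + 1) (by omega)
    rw [Nat.factorial_succ] at h1
    have hm : (m : ℂ) = k + 1 + q := by rw [h]; push_cast; ring
    rw [ascPochhammer_succ_eval, pow_succ]
    push_cast at h1
    linear_combination -h1 - (ascPochhammer ℂ k).eval (-(m : ℂ)) * (q.factorial : ℂ) * hm

/-- For k ≤ m no factor vanishes at -m, and the logarithmic derivative is -∑ 1/j over q < j ≤ m, a
difference of digamma values. -/
lemma hasDerivAt_ascPochhammer_eval_neg_natCast (k : ℕ) : ∀ {m q : ℕ}, m = k + q →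
    HasDerivAt (fun s => (ascPochhammer ℂ k).eval s)
      ((ascPochhammer ℂ k).eval (-(m : ℂ)) * (digamma ((q : ℂ) + 1) - digamma ((m : ℂ) + 1)))
      (-(m : ℂ)) := by
  induction k with
  | zero =>
    rintro m q h
    rw [zero_add] at h
    simpa [h] using hasDerivAt_const (-(q : ℂ)) (1 : ℂ)
  | succ k ih =>
    intro m q h
    have h1 := ih (m := m) (q := q + 1) (by omega)
    simp only [ascPochhammer_succ_eval]
    refine (h1.mul ((hasDerivAt_id _).add_const (k : ℂ))).congr_deriv ?_
    have hq : (q : ℂ) + 1 ≠ 0 := Nat.cast_add_one_ne_zero q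
    have hm : -(m : ℂ) + k = -((q : ℂ) + 1) := by rw [h]; push_cast; ring
    push_cast
    simp only [id]
    rw [hm, digamma_natCast_add_two]
    field_simp
    ring

/-- The factor s + m gives a simple zero, and the derivative is the product of the other factors:
-m, …, -1 and 1, …, i. -/
lemma hasDerivAt_ascPochhammer_eval_of_lt (m i : ℕ) :
    (ascPochhammer ℂ (m + 1 + i)).eval (-(m : ℂ)) = 0 ∧
    HasDerivAt (fun s => (ascPochhammer ℂ (m + 1 + i)).eval s)
      ((-1) ^ m * (m.factorial : ℂ) * (i.factorial : ℂ)) (-(m : ℂ)) := by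
  induction i with
  | zero =>
    have h0 := ascPochhammer_eval_neg_natCast_mul_factorial m (m := m) (q := 0) rfl
    have h1 := hasDerivAt_ascPochhammer_eval_neg_natCast m (m := m) (q := 0) rfl
    simp only [add_zero, ascPochhammer_succ_eval]
    refine ⟨by simp, (h1.mul ((hasDerivAt_id _).add_const (m : ℂ))).congr_deriv ?_⟩
    rw [← h0]
    simp
  | succ i ih =>
    rw [← add_assoc]
    simp only [ascPochhammer_succ_eval]
    refine ⟨by rw [ih.1, zero_mul],
      (ih.2.mul ((hasDerivAt_id _).add_const ((m + 1 + i : ℕ) : ℂ))).congr_deriv ?_⟩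
    rw [ih.1, Nat.factorial_succ]
    push_cast
    simp only [id]
    ring

/-! ### The functional f'(-m) + ψ(m+1) f(-m) on each Taylor term -/

namespace IsRegularizedHurwitz

variable {a t : ℂ} {E : ℂ → ℂ}

lemma deriv_hurwitzTaylorTerm_add_of_lt (hE : IsRegularizedHurwitz a E) {m k q : ℕ}
    (h : m = k + 1 + q) :
    deriv (hurwitzTaylorTerm E t k) (-(m : ℂ))
        + digamma ((m : ℂ) + 1) * hurwitzTaylorTerm E t k (-(m : ℂ))
      = (-1) ^ (k + 1) * (m.choose (k + 1) : ℂ) * hurwitzG q a * t ^ (k + 1) := by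
  have hmq : -(m : ℂ) + k + 1 = -(q : ℂ) := by rw [h]; push_cast; ring
  have heq : ∀ s : ℂ, s + k ≠ 0 → hurwitzTaylorTerm E t k s =
      (ascPochhammer ℂ (k + 1)).eval s / ((k + 1).factorial : ℂ)
        * hurwitzZetaC (s + k + 1) a * t ^ (k + 1) := fun s hs => by
    rw [hurwitzTaylorTerm_eq E t hs, hE.hurwitzZetaC_eq (by simpa using hs), add_sub_cancel_right]
  have hne : -(m : ℂ) + k ≠ 0 := fun h0 => by
    rw [h0, zero_add] at hmq
    exact neg_natCast_ne_one q hmq.symm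
  have hev : hurwitzTaylorTerm E t k =ᶠ[𝓝 (-(m : ℂ))] fun s =>
      (ascPochhammer ℂ (k + 1)).eval s / ((k + 1).factorial : ℂ)
        * hurwitzZetaC (s + k + 1) a * t ^ (k + 1) := by
    have : ContinuousAt (fun s : ℂ => s + k) (-(m : ℂ)) := by fun_prop
    filter_upwards [this.eventually_ne hne] with s hs using heq s hs
  have hP := hasDerivAt_ascPochhammer_eval_neg_natCast (k + 1) h
  have hZ : HasDerivAt (fun s : ℂ => hurwitzZetaC (s + k + 1) a)
      (deriv (fun s => hurwitzZetaC s a) (-(q : ℂ))) (-(m : ℂ)) := by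
    have h1 := (hE.differentiableAt_hurwitzZetaC (neg_natCast_ne_one q)).hasDerivAt
    rw [← hmq] at h1 ⊢
    have h2 : HasDerivAt (fun s : ℂ => s + k + 1) 1 (-(m : ℂ)) :=
      ((hasDerivAt_id _).add_const _).add_const _
    exact (h1.comp (-(m : ℂ)) h2).congr_deriv (mul_one _)
  have hd : HasDerivAt (fun s => (ascPochhammer ℂ (k + 1)).eval s / ((k + 1).factorial : ℂ)
        * hurwitzZetaC (s + k + 1) a * t ^ (k + 1)) _ (-(m : ℂ)) :=
    ((hP.div_const ((k + 1).factorial : ℂ)).mul hZ).mul_const (t ^ (k + 1))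
  have hval : (ascPochhammer ℂ (k + 1)).eval (-(m : ℂ)) / ((k + 1).factorial : ℂ)
      = (-1) ^ (k + 1) * (m.choose (k + 1) : ℂ) := by
    have h1 := ascPochhammer_eval_neg_natCast_mul_factorial (k + 1) h
    have h2 := Nat.choose_mul_factorial_mul_factorial (n := m) (k := k + 1) (by omega)
    rw [show m - (k + 1) = q by omega] at h2
    have hq : (q.factorial : ℂ) ≠ 0 := Nat.cast_ne_zero.mpr q.factorial_ne_zero
    have hk : ((k + 1).factorial : ℂ) ≠ 0 := Nat.cast_ne_zero.mpr (k + 1).factorial_ne_zero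
    rw [← h2] at h1
    push_cast at h1
    rw [div_eq_iff hk, ← mul_left_inj' hq, h1]
    ring
  rw [hev.deriv_eq, hd.deriv, heq _ hne, hmq, hurwitzG, ← hval]
  ring

/-- Here E is evaluated at 1: E'(1) contributes -ψ(a), while the Pochhammer derivative contributes
ψ(1) - ψ(m+1), whose second part is cancelled by the functional and whose first is -γ. -/
lemma deriv_hurwitzTaylorTerm_add_self (hE : IsRegularizedHurwitz a E) (m : ℕ) :
    deriv (hurwitzTaylorTerm E t m) (-(m : ℂ))
        + digamma ((m : ℂ) + 1) * hurwitzTaylorTerm E t m (-(m : ℂ))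
      = -((-1) ^ m / ((m : ℂ) + 1)) * t ^ (m + 1)
        * (digamma a + Real.eulerMascheroniConstant) := by
  have hP := hasDerivAt_ascPochhammer_eval_neg_natCast m (m := m) (q := 0) rfl
  have hval := ascPochhammer_eval_neg_natCast_mul_factorial m (m := m) (q := 0) rfl
  have hm : -(m : ℂ) + m + 1 = 1 := by ring
  have hE1 : HasDerivAt (fun s : ℂ => E (s + m + 1)) (-digamma a) (-(m : ℂ)) := by
    have h1 := (hE.differentiable 1).hasDerivAt
    rw [hE.deriv_one, ← hm] at h1
    have h2 : HasDerivAt (fun s : ℂ => s + m + 1) 1 (-(m : ℂ)) :=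
      ((hasDerivAt_id _).add_const _).add_const _
    exact (h1.comp (-(m : ℂ)) h2).congr_deriv (mul_one _)
  have hd : HasDerivAt (hurwitzTaylorTerm E t m) _ (-(m : ℂ)) :=
    ((hP.div_const ((m + 1).factorial : ℂ)).mul hE1).mul_const (t ^ (m + 1))
  simp only [Nat.factorial_zero, Nat.cast_one, mul_one] at hval
  rw [hd.deriv, hurwitzTaylorTerm, hm, hE.apply_one, hval, Nat.factorial_succ]
  have h1 : (m.factorial : ℂ) ≠ 0 := Nat.cast_ne_zero.mpr m.factorial_ne_zero
  have h2 : (m : ℂ) + 1 ≠ 0 := Nat.cast_add_one_ne_zero m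
  push_cast
  rw [zero_add, digamma_one]
  field_simp
  ring

lemma deriv_hurwitzTaylorTerm_add_of_gt (hE : IsRegularizedHurwitz a E) (m i : ℕ) :
    deriv (hurwitzTaylorTerm E t (m + 1 + i)) (-(m : ℂ))
        + digamma ((m : ℂ) + 1) * hurwitzTaylorTerm E t (m + 1 + i) (-(m : ℂ))
      = (-1) ^ m * (m.factorial : ℂ) * seriesTTerm t a (m + 1) (i + 1) := by
  obtain ⟨hP0, hP⟩ := hasDerivAt_ascPochhammer_eval_of_lt m i
  have hE1 : HasDerivAt (fun s : ℂ => E (s + (m + 1 + i : ℕ) + 1)) _ (-(m : ℂ)) :=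
    ((hE.differentiable.comp ((differentiable_id.add_const ((m + 1 + i : ℕ) : ℂ)).add_const
      (1 : ℂ))) (-(m : ℂ))).hasDerivAt
  have hd : HasDerivAt (hurwitzTaylorTerm E t (m + 1 + i)) _ (-(m : ℂ)) :=
    ((hP.div_const ((m + 1 + i + 1).factorial : ℂ)).mul hE1).mul_const (t ^ (m + 1 + i + 1))
  have hi : (i : ℂ) + 1 ≠ 0 := Nat.cast_add_one_ne_zero i
  have hZ := hE.hurwitzZetaC_eq (s := (i : ℂ) + 1 + 1) (by simpa using hi)
  -- Taylor index k = m + 1 + i corresponds to n = i + 1 in T, and the factorial quotient becomes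
  -- the denominator (n+1)⋯(n+p).
  have hprod : ((i + 1).factorial : ℂ) * ∏ j ∈ Finset.Icc 1 (m + 1), (((i + 1 : ℕ) : ℂ) + j)
      = ((m + 1 + i + 1).factorial : ℂ) := by
    have h1 : ∀ n : ℕ, ((i + 1).factorial : ℂ) * ∏ j ∈ Finset.Icc 1 n, (((i + 1 : ℕ) : ℂ) + j)
        = ((i + 1 + n).factorial : ℂ) := fun n => by
      induction n with
      | zero => simp
      | succ n ih =>
        rw [Finset.prod_Icc_succ_top (by omega), ← mul_assoc, ih, ← add_assoc,
          Nat.factorial_succ (i + 1 + n)]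
        push_cast
        ring
    rw [h1, show i + 1 + (m + 1) = m + 1 + i + 1 by ring]
  have hf : ((i + 1).factorial : ℂ) ≠ 0 := Nat.cast_ne_zero.mpr (i + 1).factorial_ne_zero
  have hf2 : ((m + 1 + i + 1).factorial : ℂ) ≠ 0 := Nat.cast_ne_zero.mpr (Nat.factorial_ne_zero _)
  have hp0 : ∏ j ∈ Finset.Icc 1 (m + 1), (((i + 1 : ℕ) : ℂ) + j) ≠ 0 := fun h => by
    rw [h, mul_zero] at hprod
    exact hf2 hprod.symm
  have hpt : -(m : ℂ) + ((m + 1 + i : ℕ) : ℂ) + 1 = (i : ℂ) + 1 + 1 := by push_cast; ring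
  rw [hd.deriv, hurwitzTaylorTerm, hP0, hpt, seriesTTerm, Nat.cast_add_one i, hZ,
    add_sub_cancel_right, ← Nat.cast_add_one i, ← hprod, Nat.factorial_succ i,
    show i + 1 + (m + 1) = m + 1 + i + 1 by ring]
  push_cast at hp0 ⊢
  have hf3 : (i.factorial : ℂ) ≠ 0 := Nat.cast_ne_zero.mpr i.factorial_ne_zero
  field_simp
  ring

lemma hasSum_hurwitzG_sub (hE : IsRegularizedHurwitz a E) (ha : 0 < a.re) (ht : ‖t‖ < a.re)
    (m : ℕ) :
    HasSum (fun k => deriv (hurwitzTaylorTerm E t k) (-(m : ℂ))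
        + digamma ((m : ℂ) + 1) * hurwitzTaylorTerm E t k (-(m : ℂ)))
      (hurwitzG m (a - t) - hurwitzG m a) := by
  obtain ⟨h1, h2, h3⟩ := hE.hurwitzTaylorTerm_aux ha ht (-(m : ℂ))
  have hm := neg_natCast_ne_one m
  have heq : ∀ s : ℂ, s ≠ 1 → hurwitzZetaC s (a - t)
      = hurwitzZetaC s a + ∑' k, hurwitzTaylorTerm E t k s := fun s hs => by
    have := sub_ne_zero.mpr hs
    rw [(hE.sub ha ht).hurwitzZetaC_eq hs, hE.hurwitzZetaC_eq hs]
    field_simp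
  have hev : (fun s => hurwitzZetaC s (a - t)) =ᶠ[𝓝 (-(m : ℂ))] fun s =>
      hurwitzZetaC s a + ∑' k, hurwitzTaylorTerm E t k s := by
    filter_upwards [isOpen_ne.mem_nhds hm] with s hs using heq s hs
  convert! h2.add (h1.mul_left (digamma ((m : ℂ) + 1))) using 1
  rw [hurwitzG, hurwitzG, hev.deriv_eq,
    deriv_fun_add (hE.differentiableAt_hurwitzZetaC hm) h3, heq _ hm]
  ring

end IsRegularizedHurwitz

/-! ### Solving for T -/

lemma hasSum_seriesTTerm (m : ℕ) {a t : ℂ} (ha : 0 < a.re) (ht : ‖t‖ < a.re) :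
    HasSum (fun n : ℕ => seriesTTerm t a (m + 1) (n + 1))
      (t ^ (m + 1) / ((m + 1).factorial : ℂ) * (digamma a + Real.eulerMascheroniConstant)
        + 1 / (m.factorial : ℂ) * ∑ k ∈ Finset.range (m + 1),
            (-1) ^ (k + 1) * (m.choose k : ℂ) * hurwitzG k a * t ^ (m - k)
        - (-1) ^ (m + 1) / (m.factorial : ℂ) * hurwitzG m (a - t)) := by
  obtain ⟨E, hE⟩ := exists_isRegularizedHurwitz ha
  -- The terms k ≤ m move to the other side; the tail is (-1)^m m! times T.
  have h := (hasSum_nat_add_iff' (m + 1)).mpr (hE.hasSum_hurwitzG_sub ha ht m)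
  have hm : (m.factorial : ℂ) ≠ 0 := Nat.cast_ne_zero.mpr m.factorial_ne_zero
  have hm1 : (m : ℂ) + 1 ≠ 0 := Nat.cast_add_one_ne_zero m
  have hsq : ((-1 : ℂ) ^ m) * (-1) ^ m = 1 := by rw [← mul_pow]; simp
  have hsum : ∑ k ∈ Finset.range (m + 1),
      (-1 : ℂ) ^ (k + 1) * (m.choose k : ℂ) * hurwitzG k a * t ^ (m - k)
      = -(-1) ^ m * (hurwitzG m a + ∑ k ∈ Finset.range m,
        (-1) ^ (k + 1) * (m.choose (k + 1) : ℂ) * hurwitzG (m - (k + 1)) a * t ^ (k + 1)) := by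
    -- Reversing k ↦ m - k matches the powers of t; the split-off term g(m, a) comes from the
    -- left-hand side of the Taylor identity.
    rw [← Finset.sum_range_reflect, Finset.sum_range_succ', mul_add, add_comm, Finset.mul_sum]
    congr 1
    · simp [pow_succ]
    · refine Finset.sum_congr rfl fun k hk => ?_
      obtain ⟨q, rfl⟩ := Nat.exists_eq_add_of_le (Nat.succ_le_of_lt (Finset.mem_range.mp hk))
      have h1 : k.succ + q + 1 - 1 - (k + 1) = q := by omega
      have h2 : k.succ + q - (k + 1) = q := by omega
      have h3 : k.succ + q - q = k + 1 := by omega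
      have h4 : (k.succ + q).choose q = (k.succ + q).choose (k + 1) :=
        Nat.choose_symm_of_eq_add (by simp [add_comm])
      have h5 : (-1 : ℂ) ^ (k + 1) * (-1) ^ (k + 1) = 1 := by rw [← mul_pow]; simp
      rw [h1, h2, h3, h4, Nat.succ_eq_add_one, pow_succ, pow_add _ (k + 1) q]
      linear_combination ((-1) ^ q * ((k + 1 + q).choose (k + 1) : ℂ) * hurwitzG q a
        * t ^ (k + 1)) * h5
  have h' := h.mul_left ((-1) ^ m / (m.factorial : ℂ))
  rw [hsum]
  convert! h' using 1
  · ext n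
    rw [add_comm n (m + 1), hE.deriv_hurwitzTaylorTerm_add_of_gt]
    field_simp
    linear_combination -seriesTTerm t a (m + 1) (n + 1) * hsq
  · rw [Finset.sum_range_succ, hE.deriv_hurwitzTaylorTerm_add_self,
      Finset.sum_congr rfl fun k hk => hE.deriv_hurwitzTaylorTerm_add_of_lt (q := m - (k + 1))
        (by have := Finset.mem_range.mp hk; omega), Nat.factorial_succ]
    push_cast
    field_simp
    linear_combination -(t ^ (m + 1) * (digamma a + Real.eulerMascheroniConstant)) * hsq

theorem theorem2 (p : ℕ) (hp : 1 ≤ p) (a t : ℂ) (ha : 0 < a.re) (ht : ‖t‖ < a.re) :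
    Summable (fun n : ℕ => seriesTTerm t a p (n + 1)) ∧
    seriesT t a p =
      t ^ p / (p.factorial : ℂ) * (Complex.digamma a + (Real.eulerMascheroniConstant : ℂ))
      + 1 / ((p - 1).factorial : ℂ) *
          ∑ k ∈ Finset.range p,
            (-1 : ℂ) ^ (k + 1) * ((p - 1).choose k : ℂ) * hurwitzG k a * t ^ (p - k - 1)
      - (-1 : ℂ) ^ p / ((p - 1).factorial : ℂ) * hurwitzG (p - 1) (a - t) := by
  obtain ⟨m, rfl⟩ := Nat.exists_eq_add_of_le' hp
  have h := hasSum_seriesTTerm m ha ht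
  refine ⟨h.summable, ?_⟩
  rw [seriesT, h.tsum_eq]
  simp only [Nat.add_sub_cancel, Nat.sub_right_comm (m + 1) _ 1]
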